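/- For a finite simple graph $G$ with adjacency matrix $A(G)$ let $S(G)=J-I-2A(G)$ be its Seidel matrix, where $J$ is the all-ones matrix; the Seidel spectrum of $G$ is the multiset of eigenvalues of $S(G)$, i.e. of roots (with multiplicity) of $\det(\lambda I-S(G))$. For $U\subseteq V(G)$, Seidel switching with respect to $U$ deletes all edges between $U$ and $V(G)\setminus U$ and adds all edges between $U$ and $V(G)\setminus U$ that were not present in $G$; two graphs on the same vertex set are switching equivalent if one is obtained from the other by a Seidel switching. A graph $G$ is $S$-determined if every finite simple graph $H$ with the same Seidel spectrum as $G$ is switching equivalent to a graph isomorphic to $G$. Let $n_1,n_2,n_3,n_4\ge 1$ be integers such that $\max\{n_1,n_2,n_3,n_4\}$ is prime. Then the complete $4$-partite graph $K_{n_1,n_2,n_3,n_4}$, whose vertex set is partitioned into parts of sizes $n_1,n_2,n_3,n_4$ and in which two vertices are adjacent if and only if they lie in different parts, is $S$-determined. -/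

import Mathlib

universe u v

/-- The Seidel matrix `S(G) = J - I - 2 A(G)` of a finite simple graph, over the reals. -/
noncomputable def seidelMatrix {V : Type u} [Fintype V] [DecidableEq V] (G : SimpleGraph V) :
    Matrix V V ℝ :=
  letI : DecidableRel G.Adj := Classical.decRel _
  Matrix.of (fun _ _ => (1 : ℝ)) - 1 - (2 : ℝ) • G.adjMatrix ℝ

/-- The Seidel spectrum: the multiset of roots (with multiplicity) of the
Seidel characteristic polynomial `det (x I - S(G))`. The matrix `S(G)` is real symmetric, so all
its eigenvalues are real and none is lost by taking the roots in `ℝ`. -/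
noncomputable def seidelSpectrum {V : Type u} [Fintype V] [DecidableEq V] (G : SimpleGraph V) :
    Multiset ℝ :=
  (seidelMatrix G).charpoly.roots

/-- Seidel switching of `G` with respect to `U`: between `U` and its complement, edges and
non-edges are exchanged; all other adjacencies are kept. -/
def seidelSwitch {V : Type u} (G : SimpleGraph V) (U : Set V) : SimpleGraph V where
  Adj x y := ((x ∈ U ↔ y ∈ U) ∧ G.Adj x y) ∨ (¬ (x ∈ U ↔ y ∈ U) ∧ ¬ G.Adj x y)
  symm := ⟨fun x y h => by
    rw [G.adj_comm y x, iff_comm (a := y ∈ U)]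
    exact h⟩
  loopless := ⟨fun x h => by simp at h⟩

/-- Two graphs on the same vertex set are switching equivalent if one arises from the other by a
Seidel switching. -/
def SwitchingEquivalent {V : Type u} (G H : SimpleGraph V) : Prop :=
  ∃ U : Set V, H = seidelSwitch G U

/-- `G` is determined, up to switching, by its Seidel spectrum: every finite graph with the same
Seidel spectrum is switching equivalent to a graph isomorphic to `G`. -/
def IsSeidelDetermined {V : Type u} [Fintype V] [DecidableEq V] (G : SimpleGraph V) : Prop :=
  ∀ (W : Type v) [Fintype W] [DecidableEq W] (H : SimpleGraph W),
    seidelSpectrum H = seidelSpectrum G →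
      ∃ G' : SimpleGraph W, Nonempty (G' ≃g G) ∧ SwitchingEquivalent H G'

/-! For a complete 4-partite graph, `S + I` is a blow-up of `Q = 2I - J` of order 4, so it has rank
4, and the spectrum passes this rank on to `S(H) + I`. A symmetric sign matrix with unit diagonal
and rank 4 is itself a blow-up of `Q` up to signs (`exists_isSignedBlowup`), so `H` switches to a
complete 4-partite graph.

It remains to compare part sizes. The characteristic polynomial of `Q` times the diagonal matrix of
sizes gives the elementary symmetric functions e1, e3, e4 but not e2. Primality of the largest part
recovers e2 (`esymm_two_eq_of_prime`), and then the sizes agree as multisets. -/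

/-! ### Arithmetic of the part sizes. -/

theorem esymm_two_eq_of_prime {p a b c q x y z : ℕ} (hp : p.Prime) (ha : a ≤ p) (hb : b ≤ p)
    (hc : c ≤ p) (hq : 0 < q) (hx : 0 < x) (hy : 0 < y) (hz : 0 < z) (hpq : p ∣ q)
    (h1 : p + a + b + c = q + x + y + z)
    (h3 : p * a * b + p * a * c + p * b * c + a * b * c
      = q * x * y + q * x * z + q * y * z + x * y * z)
    (h4 : p * a * b * c = q * x * y * z) :
    p * a + p * b + p * c + a * b + a * c + b * c
      = q * x + q * y + q * z + x * y + x * z + y * z := by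
  have hp0 := hp.pos
  by_cases hmem : p = q ∨ p = x ∨ p = y ∨ p = z
  -- The two quartics with these roots differ only in e2 times the square of the variable, and both
  -- vanish at `p`.
  · have h0 : ((p : ℤ) - q) * (p - x) * (p - y) * (p - z) = 0 := by
      rcases hmem with h | h | h | h <;> rw [h] <;> ring
    zify at h1 h3 h4 ⊢
    have hp2 : ((p : ℤ) ^ 2) ≠ 0 := by positivity
    refine mul_left_cancel₀ hp2 ?_
    linear_combination (p : ℤ) ^ 3 * h1 + (p : ℤ) * h3 - h4 - h0
  · exfalso
    push Not at hmem
    obtain ⟨hq', hx', hy', hz'⟩ := hmem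
    obtain ⟨k, rfl⟩ := hpq
    -- The total is at most `4 * p`, and `x`, `y`, `z` are positive.
    have hk : k ≤ 3 := by
      by_contra! h
      nlinarith
    have hk2 : 2 ≤ k := by
      by_contra! h
      interval_cases k <;> simp_all
    have h4' : a * b * c = k * x * y * z := by
      refine Nat.eq_of_mul_eq_mul_left hp0 ?_
      linarith
    have hd : p ∣ (k - 1) * (x * y * z) := by
      zify [show 1 ≤ k by omega] at h3 h4' ⊢
      refine ⟨k * x * y + k * x * z + k * y * z - a * b - a * c - b * c, ?_⟩
      linear_combination h3 - h4'
    have hle : ∀ w, 0 < w → p ∣ w → p ≠ w → 2 * p ≤ w := by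
      rintro w hw ⟨l, rfl⟩ hne
      have : l ≠ 0 := by rintro rfl; simp at hw
      have : l ≠ 1 := by rintro rfl; simp at hne
      have : 2 ≤ l := by omega
      nlinarith
    have hkp : 2 * p ≤ p * k := by nlinarith
    -- `p ∣ k - 1` forces `p = 2`, `k = 3`, so the total is at least 9 > 8. If `p` divides one of
    -- `x`, `y`, `z`, that part and `q` already use up `4 * p`.
    rcases hp.dvd_mul.1 hd with h | h
    · have := Nat.le_of_dvd (by omega) h
      have := hp.two_le
      have : k = 3 := by omega
      subst this
      omega
    · rcases hp.dvd_mul.1 h with h | h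
      · rcases hp.dvd_mul.1 h with h | h
        · have := hle x hx h hx'
          omega
        · have := hle y hy h hy'
          omega
      · have := hle z hz h hz'
        omega

open Polynomial in
theorem exists_perm_of_esymm_eq {n m : Fin 4 → ℕ} (hn : ∀ i, 0 < n i)
    (hprime : (Finset.univ.sup n).Prime)
    (h1 : n 0 + n 1 + n 2 + n 3 = m 0 + m 1 + m 2 + m 3)
    (h3 : n 0 * n 1 * n 2 + n 0 * n 1 * n 3 + n 0 * n 2 * n 3 + n 1 * n 2 * n 3
      = m 0 * m 1 * m 2 + m 0 * m 1 * m 3 + m 0 * m 2 * m 3 + m 1 * m 2 * m 3)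
    (h4 : n 0 * n 1 * n 2 * n 3 = m 0 * m 1 * m 2 * m 3) :
    ∃ σ : Equiv.Perm (Fin 4), ∀ i, n (σ i) = m i := by
  have hm : ∀ i, 0 < m i := by
    have hne : m 0 * m 1 * m 2 * m 3 ≠ 0 := by
      rw [← h4]
      exact (Nat.mul_pos (Nat.mul_pos (Nat.mul_pos (hn 0) (hn 1)) (hn 2)) (hn 3)).ne'
    simp only [mul_ne_zero_iff] at hne
    intro i
    fin_cases i <;> simp <;> omega
  obtain ⟨i, -, hi⟩ := Finset.exists_mem_eq_sup Finset.univ Finset.univ_nonempty n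
  have hle : ∀ l, n l ≤ n i := fun l => hi ▸ Finset.le_sup (Finset.mem_univ l)
  rw [hi] at hprime
  have hd : n i ∣ ∏ l, m l := by
    rw [Fin.prod_univ_four, ← h4, ← Fin.prod_univ_four]
    exact Finset.dvd_prod_of_mem n (Finset.mem_univ i)
  obtain ⟨j, -, hj⟩ := (hprime.prime.dvd_finsetProd_iff _).1 hd
  have h2 : n 0 * n 1 + n 0 * n 2 + n 0 * n 3 + n 1 * n 2 + n 1 * n 3 + n 2 * n 3
      = m 0 * m 1 + m 0 * m 2 + m 0 * m 3 + m 1 * m 2 + m 1 * m 3 + m 2 * m 3 := by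
    have key : ∀ i₁ i₂ i₃ j₁ j₂ j₃ : Fin 4, _ := fun i₁ i₂ i₃ j₁ j₂ j₃ =>
      esymm_two_eq_of_prime hprime (hle i₁) (hle i₂) (hle i₃)
        (hm j) (hm j₁) (hm j₂) (hm j₃) hj
    -- The three indices other than the given one.
    let k : Fin 4 → Fin 4 × Fin 4 × Fin 4 := ![(1, 2, 3), (0, 2, 3), (0, 1, 3), (0, 1, 2)]
    replace key := key (k i).1 (k i).2.1 (k i).2.2 (k j).1 (k j).2.1 (k j).2.2
    fin_cases i <;> fin_cases j <;> dsimp [k] at key <;>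
      linear_combination
        key (by linear_combination h1) (by linear_combination h3) (by linear_combination h4)
  have hpoly : ∏ l, (X - C (n l : ℤ)) = ∏ l, (X - C (m l : ℤ)) := by
    refine Polynomial.funext fun t => ?_
    simp only [Fin.prod_univ_four, eval_mul, eval_sub, eval_X, eval_C]
    zify at h1 h2 h3 h4
    linear_combination -t ^ 3 * h1 + t ^ 2 * h2 - t * h3 + h4
  have hr := congrArg Polynomial.roots hpoly
  simp only [Finset.prod_eq_multiset_prod] at hr
  have hmap (f : Fin 4 → ℕ) : (Finset.univ.val.map fun l => X - C (f l : ℤ)) =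
      (Finset.univ.val.map fun l => (f l : ℤ)).map fun t => X - C t := by simp
  rw [hmap, hmap, roots_multiset_prod_X_sub_C, roots_multiset_prod_X_sub_C] at hr
  have hcount (v : ℕ) : Fintype.card {i // n i = v} = Fintype.card {i // m i = v} := by
    have hc := congrArg (Multiset.count (v : ℤ)) hr
    rw [Multiset.count_map, Multiset.count_map] at hc
    simpa [-Fin.univ_val_map, Fintype.card_subtype, Finset.card_def, eq_comm] using hc
  let e := Equiv.ofFiberEquiv fun v => Fintype.equivOfCardEq (hcount v)
  refine ⟨e.symm, fun i => ?_⟩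
  rw [← Equiv.ofFiberEquiv_map (f := n) (g := m) (fun v => Fintype.equivOfCardEq (hcount v))]
  exact congrArg m (e.apply_symm_apply i)

/-! ### Signed blow-ups of the quotient matrix. -/

section

open Matrix

/-- The quotient matrix `S + I` of a complete `4`-partite graph: `1` on the diagonal, `-1` off it. -/
def quotientMatrix : Matrix (Fin 4) (Fin 4) ℝ :=
  !![1, -1, -1, -1; -1, 1, -1, -1; -1, -1, 1, -1; -1, -1, -1, 1]

theorem quotientMatrix_apply (i j : Fin 4) : quotientMatrix i j = if i = j then 1 else -1 := by
  fin_cases i <;> fin_cases j <;> simp [quotientMatrix]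

theorem quotientMatrix_mul_self : quotientMatrix * quotientMatrix = (4 : ℝ) • 1 := by
  ext i j
  fin_cases i <;> fin_cases j <;> simp [quotientMatrix, mul_apply, Fin.sum_univ_four] <;> norm_num

theorem isUnit_quotientMatrix : IsUnit quotientMatrix := by
  refine IsUnit.of_mul_eq_one ((4 : ℝ)⁻¹ • quotientMatrix) ?_
  rw [mul_smul_comm, quotientMatrix_mul_self, smul_smul]
  norm_num

/-- The principal minors of `quotientMatrix` of orders 1, 2, 3, 4 are 1, 0, -4, -16; the zero is why
e2 is lost. -/
theorem eval_charpoly_quotientMatrix_mul_diagonal (d : Fin 4 → ℝ) (t : ℝ) :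
    (quotientMatrix * diagonal d).charpoly.eval t = t ^ 4 - (d 0 + d 1 + d 2 + d 3) * t ^ 3
      + 4 * (d 0 * d 1 * d 2 + d 0 * d 1 * d 3 + d 0 * d 2 * d 3 + d 1 * d 2 * d 3) * t
      - 16 * (d 0 * d 1 * d 2 * d 3) := by
  rw [eval_charpoly]
  have : scalar (Fin 4) t - quotientMatrix * diagonal d =
      !![t - d 0, d 1, d 2, d 3; d 0, t - d 1, d 2, d 3; d 0, d 1, t - d 2, d 3;
        d 0, d 1, d 2, t - d 3] := by
    ext i j
    rw [Matrix.sub_apply, mul_diagonal, quotientMatrix_apply, scalar_apply, diagonal_apply]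
    fin_cases i <;> fin_cases j <;> simp
  rw [this]
  simp [det_succ_row_zero, Fin.sum_univ_succ, Fin.succAbove]
  ring

/-- `M` is, up to the signs `s`, the blow-up of `quotientMatrix` along `f`. -/
def IsSignedBlowup {W : Type*} (M : Matrix W W ℝ) (f : W → Fin 4) (s : W → ℝ) : Prop :=
  (∀ u, s u = 1 ∨ s u = -1) ∧ ∀ u v, M u v = s u * s v * quotientMatrix (f u) (f v)

section
variable {W : Type*} [Fintype W] [DecidableEq W] {M : Matrix W W ℝ} {f : W → Fin 4} {s : W → ℝ}

/-- The signed indicator matrix of a map to `Fin 4`. -/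
def signedIndicator (f : W → Fin 4) (s : W → ℝ) : Matrix W (Fin 4) ℝ :=
  of fun u i => if f u = i then s u else 0

omit [Fintype W] [DecidableEq W] in
theorem IsSignedBlowup.eq_mul (h : IsSignedBlowup M f s) :
    M = signedIndicator f s * (quotientMatrix * (signedIndicator f s)ᵀ) := by
  ext u v
  simp [signedIndicator, mul_apply, h.2 u v]
  ring

omit [DecidableEq W] in
theorem IsSignedBlowup.transpose_mul_signedIndicator (h : IsSignedBlowup M f s) :
    (signedIndicator f s)ᵀ * signedIndicator f s =
      diagonal fun i => (Fintype.card {u // f u = i} : ℝ) := by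
  have hs : ∀ u, s u * s u = 1 := fun u => by rcases h.1 u with h | h <;> simp [h]
  ext i j
  rcases eq_or_ne i j with rfl | hij
  · simp [signedIndicator, mul_apply, Fintype.card_subtype, hs, ← ite_and]
  · rw [diagonal_apply_ne _ hij, mul_apply]
    refine Finset.sum_eq_zero fun u _ => ?_
    simp only [signedIndicator, transpose_apply, of_apply]
    split_ifs with h1 h2 <;> simp
    exact absurd (h1.symm.trans h2) hij

theorem IsSignedBlowup.charpoly (h : IsSignedBlowup M f s) :
    Polynomial.X ^ 4 * M.charpoly = Polynomial.X ^ Fintype.card W *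
      (quotientMatrix * diagonal fun i => (Fintype.card {u // f u = i} : ℝ)).charpoly := by
  have := charpoly_mul_comm' (signedIndicator f s) (quotientMatrix * (signedIndicator f s)ᵀ)
  rwa [← h.eq_mul, Fintype.card_fin, Matrix.mul_assoc, h.transpose_mul_signedIndicator] at this

omit [DecidableEq W] in
theorem IsSignedBlowup.rank_eq (h : IsSignedBlowup M f s) (hf : Function.Surjective f) :
    M.rank = 4 := by
  have hD : IsUnit (diagonal fun i => (Fintype.card {u // f u = i} : ℝ)) := by
    rw [isUnit_diagonal, Pi.isUnit_iff]
    intro i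
    rw [isUnit_iff_ne_zero, Nat.cast_ne_zero]
    obtain ⟨u, hu⟩ := hf i
    exact (Fintype.card_pos_iff.2 ⟨⟨u, hu⟩⟩).ne'
  refine le_antisymm ?_ ?_
  · rw [h.eq_mul]
    exact (rank_mul_le_left _ _).trans (rank_le_card_width (signedIndicator f s))
  · set P := signedIndicator f s
    have hDBD : Pᵀ * M * P = Pᵀ * P * quotientMatrix * (Pᵀ * P) := by
      rw [h.eq_mul]
      simp only [P, Matrix.mul_assoc]
    have hr : (Pᵀ * M * P).rank = 4 := by
      rw [hDBD, h.transpose_mul_signedIndicator,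
        rank_of_isUnit _ ((hD.mul isUnit_quotientMatrix).mul hD), Fintype.card_fin]
    rw [← hr]
    exact (rank_mul_le_left _ _).trans (rank_mul_le_right _ _)

/-! ### Rank of symmetric matrices and its spectral meaning. -/

theorem Matrix.IsHermitian.rank_eq_countP_roots_charpoly (hM : M.IsHermitian) :
    M.rank = M.charpoly.roots.countP (· ≠ 0) := by
  rw [hM.roots_charpoly_eq_eigenvalues, hM.rank_eq_card_non_zero_eigs, Multiset.countP_map,
    Fintype.card_subtype]
  simp [Finset.card_def]

theorem Matrix.isUnit_of_rank_eq_card {K : Type*} [Field K] {A : Matrix W W K}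
    (h : A.rank = Fintype.card W) : IsUnit A := by
  rw [← mulVec_surjective_iff_isUnit]
  refine (LinearMap.range_eq_top (f := A.mulVecLin)).1 (Submodule.eq_top_of_finrank_eq ?_)
  rwa [Module.finrank_fintype_fun_eq_card]

omit [DecidableEq W] in
-- Expand every row in a basis of `k` chosen rows; by symmetry the same coefficients expand the
-- columns.
theorem Matrix.IsSymm.exists_eq_mul_submatrix_mul {k : ℕ} (hM : M.IsSymm) (hr : M.rank = k) :
    ∃ (I : Fin k → W) (C : Matrix W (Fin k) ℝ),
      M.submatrix id I = C * M.submatrix I I ∧ M = C * M.submatrix I I * Cᵀ := by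
  rw [rank_eq_finrank_span_row] at hr
  subst hr
  obtain ⟨g, hg, hspan, -⟩ := Submodule.exists_fun_fin_finrank_span_eq ℝ (Set.range M.row)
  choose I hI using hg
  have hmem (u : W) : ∃ c : _ → ℝ, ∑ i, c i • g i = M.row u := by
    rw [← Submodule.mem_span_range_iff_exists_fun, hspan]
    exact Submodule.subset_span ⟨u, rfl⟩
  choose C hC using hmem
  have hrow (u v : W) : M u v = ∑ i, C u i * M (I i) v := by
    rw [← M.row_apply, ← hC, Finset.sum_apply]
    simp [← hI]
  have h1 : M.submatrix id I = of C * M.submatrix I I := by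
    ext u j
    simp [mul_apply, ← hrow]
  refine ⟨I, of C, h1, ?_⟩
  rw [← h1]
  ext u v
  rw [← hM.apply, hrow v u]
  simp [mul_apply, ← hM.apply u, mul_comm]

/-! ### Classification of sign matrices of rank 4. -/

theorem eq_one_or_neg_one_mul {a b : ℝ} (ha : a = 1 ∨ a = -1) (hb : b = 1 ∨ b = -1) :
    a * b = 1 ∨ a * b = -1 := by
  rcases ha with rfl | rfl <;> rcases hb with rfl | rfl <;> norm_num

/-- A nonsingular symmetric sign matrix of order `4` with unit diagonal is the quotient matrix up to
signs. -/
theorem exists_diagonal_mul_mul_diagonal_eq {N : Matrix (Fin 4) (Fin 4) ℝ} (hN : N.IsSymm)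
    (hdiag : ∀ i, N i i = 1) (hsign : ∀ i j, N i j = 1 ∨ N i j = -1) (hdet : IsUnit N) :
    ∃ t : Fin 4 → ℝ, (∀ i, t i = 1 ∨ t i = -1) ∧
      diagonal t * N * diagonal t = quotientMatrix := by
  have hd : N.det ≠ 0 := ((isUnit_iff_isUnit_det N).1 hdet).ne_zero
  have hN' : N = !![1, N 0 1, N 0 2, N 0 3; N 0 1, 1, N 1 2, N 1 3; N 0 2, N 1 2, 1, N 2 3;
      N 0 3, N 1 3, N 2 3, 1] := by
    ext i j
    fin_cases i <;> fin_cases j <;> first | exact hdiag _ | rfl | exact hN.apply _ _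
  rw [hN'] at hd
  -- These signs make the first row `(1, -1, -1, -1)`.
  refine ⟨![1, -N 0 1, -N 0 2, -N 0 3], ?_, ?_⟩
  · intro i
    fin_cases i
    · simp
    · rcases hsign 0 1 with h | h <;> simp [h]
    · rcases hsign 0 2 with h | h <;> simp [h]
    · rcases hsign 0 3 with h | h <;> simp [h]
  -- Up to switching, a graph on 4 vertices is empty, a single edge or complete; the first two give
  -- repeated rows, hence determinant 0. In the complete case every triangle has product -1.
  have hdet' {a b c x y z : ℝ} (ha : a = 1 ∨ a = -1) (hb : b = 1 ∨ b = -1) (hc : c = 1 ∨ c = -1)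
      (hx : x = 1 ∨ x = -1) (hy : y = 1 ∨ y = -1) (hz : z = 1 ∨ z = -1)
      (h : det !![1, a, b, c; a, 1, x, y; b, x, 1, z; c, y, z, 1] ≠ 0) :
      a * x * b = -1 ∧ a * y * c = -1 ∧ b * z * c = -1 := by
    have heq : det !![1, a, b, c; a, 1, x, y; b, x, 1, z; c, y, z, 1] =
        1 - a ^ 2 - b ^ 2 - c ^ 2 - x ^ 2 - y ^ 2 - z ^ 2 + 2 * (a * x * b) + 2 * (a * y * c)
        + 2 * (b * z * c) + 2 * (x * y * z) + (a * z) ^ 2 + (b * y) ^ 2 + (c * x) ^ 2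
        - 2 * (a * z) * (b * y) - 2 * (a * z) * (c * x) - 2 * (b * y) * (c * x) := by
      simp [det_succ_row_zero, Fin.sum_univ_succ, Fin.succAbove]
      ring
    rw [heq] at h
    revert h
    rcases ha with rfl | rfl <;> rcases hb with rfl | rfl <;> rcases hc with rfl | rfl <;>
      rcases hx with rfl | rfl <;> rcases hy with rfl | rfl <;> rcases hz with rfl | rfl <;>
      norm_num
  obtain ⟨h1, h2, h3⟩ := hdet' (hsign 0 1) (hsign 0 2) (hsign 0 3) (hsign 1 2) (hsign 1 3)
    (hsign 2 3) hd
  have hs (i j : Fin 4) : N i j * N i j = 1 := by rcases hsign i j with h | h <;> rw [h] <;> norm_num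
  rw [hN']
  ext i j
  rw [mul_diagonal, diagonal_mul, quotientMatrix_apply]
  fin_cases i <;> fin_cases j <;> simp [hs] <;> linarith

/-- As the form is `2 ∑ w j ^ 2 - (∑ w j) ^ 2`, the value 4 means `∑ w j = ±2`: exactly one entry
has the minority sign, as in a row of the quotient matrix. -/
theorem exists_eq_mul_quotientMatrix {w : Fin 4 → ℝ} (hw : ∀ j, w j = 1 ∨ w j = -1)
    (h : 4 = ∑ j, (∑ i, w i * quotientMatrix i j) * w j) :
    ∃ (i : Fin 4) (σ : ℝ), (σ = 1 ∨ σ = -1) ∧ ∀ j, w j = σ * quotientMatrix i j := by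
  have h' : (w 0 + w 1 + w 2 + w 3) ^ 2 = 2 * (w 0 ^ 2 + w 1 ^ 2 + w 2 ^ 2 + w 3 ^ 2) - 4 := by
    rw [h]
    simp [Fin.sum_univ_four, quotientMatrix]
    ring
  have hw' : w = ![w 0, w 1, w 2, w 3] := by
    ext j
    fin_cases j <;> rfl
  rw [hw']
  clear h hw'
  rcases hw 0 with h0 | h0 <;> rcases hw 1 with h1 | h1 <;> rcases hw 2 with h2 | h2 <;>
    rcases hw 3 with h3 | h3 <;> rw [h0, h1, h2, h3] at h' ⊢ <;>
    first
    | (exfalso; revert h'; norm_num; done)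
    | (refine ⟨0, 1, ?_, ?_⟩ <;> simp [Fin.forall_fin_succ, quotientMatrix]; done)
    | (refine ⟨1, 1, ?_, ?_⟩ <;> simp [Fin.forall_fin_succ, quotientMatrix]; done)
    | (refine ⟨2, 1, ?_, ?_⟩ <;> simp [Fin.forall_fin_succ, quotientMatrix]; done)
    | (refine ⟨3, 1, ?_, ?_⟩ <;> simp [Fin.forall_fin_succ, quotientMatrix]; done)
    | (refine ⟨0, -1, ?_, ?_⟩ <;> simp [Fin.forall_fin_succ, quotientMatrix]; done)
    | (refine ⟨1, -1, ?_, ?_⟩ <;> simp [Fin.forall_fin_succ, quotientMatrix]; done)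
    | (refine ⟨2, -1, ?_, ?_⟩ <;> simp [Fin.forall_fin_succ, quotientMatrix]; done)
    | (refine ⟨3, -1, ?_, ?_⟩ <;> simp [Fin.forall_fin_succ, quotientMatrix])

omit [DecidableEq W] in
theorem exists_isSignedBlowup (hM : M.IsSymm) (hdiag : ∀ u, M u u = 1)
    (hsign : ∀ u v, M u v = 1 ∨ M u v = -1) (hr : M.rank = 4) :
    ∃ (f : W → Fin 4) (s : W → ℝ), IsSignedBlowup M f s := by
  obtain ⟨I, C, hMI, hMC⟩ := hM.exists_eq_mul_submatrix_mul hr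
  have hunit : IsUnit (M.submatrix I I) := by
    refine isUnit_of_rank_eq_card (le_antisymm (rank_le_card_width _) ?_)
    have hle : M.rank ≤ (M.submatrix I I).rank := by
      conv_lhs => rw [hMC]
      exact (rank_mul_le_left _ _).trans (rank_mul_le_right _ _)
    rwa [hr] at hle
  obtain ⟨t, ht, htN⟩ := exists_diagonal_mul_mul_diagonal_eq (hM.submatrix I)
    (fun i => hdiag _) (fun i j => hsign _ _) hunit
  set N := M.submatrix I I
  have htt : diagonal t * diagonal t = 1 := by
    rw [diagonal_mul_diagonal, ← diagonal_one]
    congr 1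
    ext i
    rcases ht i with h | h <;> rw [h] <;> norm_num
  have hNt : N = diagonal t * quotientMatrix * diagonal t := by
    rw [← htN]
    simp only [Matrix.mul_assoc, htt, Matrix.mul_one]
    simp only [← Matrix.mul_assoc, htt, Matrix.one_mul]
  have hQ : quotientMatrixᵀ = quotientMatrix := by
    ext i j
    simp [quotientMatrix_apply, eq_comm]
  -- Since the quotient matrix squares to 4, it inverts `N` up to signs and a factor 4, which
  -- eliminates `C`. The diagonal entries of this identity constrain each row separately.
  have hM4 : (4 : ℝ) • M = (M.submatrix id I * diagonal t) * quotientMatrix *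
      (M.submatrix id I * diagonal t)ᵀ := by
    have hW : M.submatrix id I * diagonal t = C * diagonal t * quotientMatrix := by
      rw [hMI, hNt]
      simp only [Matrix.mul_assoc, htt, Matrix.mul_one]
    rw [hW]
    conv_lhs => rw [hMC, hNt]
    simp only [transpose_mul, hQ, diagonal_transpose]
    rw [Matrix.mul_assoc _ quotientMatrix quotientMatrix, quotientMatrix_mul_self]
    simp [Matrix.mul_assoc]
  obtain ⟨w, hw⟩ : ∃ w : W → Fin 4 → ℝ, ∀ u j, w u j = M u (I j) * t j := ⟨_, fun _ _ => rfl⟩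
  have hM4' (u v : W) : 4 * M u v = ∑ j, (∑ i, w u i * quotientMatrix i j) * w v j := by
    have := congrFun₂ hM4 u v
    rw [Matrix.smul_apply, smul_eq_mul] at this
    rw [this, mul_apply]
    simp only [Matrix.mul_apply (N := quotientMatrix), mul_diagonal, transpose_apply,
      submatrix_apply, id, hw]
  have hrow (u : W) : ∃ (i : Fin 4) (σ : ℝ), (σ = 1 ∨ σ = -1) ∧
      ∀ j, w u j = σ * quotientMatrix i j := by
    refine exists_eq_mul_quotientMatrix (fun j => ?_) ?_
    · rw [hw]
      exact eq_one_or_neg_one_mul (hsign _ _) (ht j)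
    · rw [← hM4', hdiag, mul_one]
  choose f s hs hfs using hrow
  refine ⟨f, s, hs, fun u v => ?_⟩
  have hQQ (i j : Fin 4) : ∑ k, quotientMatrix i k * quotientMatrix k j = if i = j then 4 else 0 := by
    rw [← mul_apply, quotientMatrix_mul_self]
    simp [Matrix.one_apply]
  have h4 := hM4' u v
  have hsum : ∑ j, (∑ i, w u i * quotientMatrix i j) * w v j =
      s u * s v * (4 * quotientMatrix (f u) (f v)) := by
    have h1 (j : Fin 4) : ∑ i, w u i * quotientMatrix i j = s u * if f u = j then 4 else 0 := by
      simp only [hfs, mul_assoc, ← Finset.mul_sum, hQQ]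
    simp only [h1]
    simp only [hfs, mul_ite, mul_zero, ite_mul, zero_mul, Finset.sum_ite_eq, Finset.mem_univ,
      if_true]
    rw [quotientMatrix_apply, quotientMatrix_apply]
    simp only [eq_comm (a := f v)]
    ring
  linarith
end

/-! ### Seidel matrices, switching and isomorphism. -/

section
variable {V : Type u} [Fintype V] [DecidableEq V]

theorem seidelMatrix_add_one_apply (G : SimpleGraph V) (x y : V) [Decidable (G.Adj x y)] :
    (seidelMatrix G + 1) x y = if G.Adj x y then -1 else 1 := by
  classical
  simp only [seidelMatrix, sub_add_eq_add_sub, Matrix.sub_apply, of_apply,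
    Matrix.smul_apply, Matrix.add_apply, SimpleGraph.adjMatrix_apply]
  split_ifs <;> norm_num

theorem isSymm_seidelMatrix (G : SimpleGraph V) : (seidelMatrix G).IsSymm := by
  classical
  simp only [seidelMatrix]
  exact ((IsSymm.ext fun _ _ => rfl).sub isSymm_one).sub ((G.isSymm_adjMatrix).smul _)

theorem isSymm_seidelMatrix_add_one (G : SimpleGraph V) : (seidelMatrix G + 1).IsSymm :=
  (isSymm_seidelMatrix G).add isSymm_one

omit [Fintype V] [DecidableEq V] in
theorem Matrix.IsSymm.isHermitian {M : Matrix V V ℝ} (hM : M.IsSymm) : M.IsHermitian := by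
  rw [IsHermitian, conjTranspose_eq_transpose_of_trivial, hM]

theorem charpoly_seidelMatrix_eq_of_seidelSpectrum_eq {W : Type v} [Fintype W] [DecidableEq W]
    {G : SimpleGraph V} {H : SimpleGraph W} (h : seidelSpectrum H = seidelSpectrum G) :
    (seidelMatrix H).charpoly = (seidelMatrix G).charpoly := by
  rw [(isSymm_seidelMatrix H).isHermitian.splits_charpoly.eq_prod_roots_of_monic
      (charpoly_monic _),
    (isSymm_seidelMatrix G).isHermitian.splits_charpoly.eq_prod_roots_of_monic
      (charpoly_monic _)]
  exact congrArg (fun s => (Multiset.map (fun a => Polynomial.X - Polynomial.C a) s).prod) h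

theorem charpoly_add_one (M : Matrix V V ℝ) :
    (M + 1).charpoly = M.charpoly.comp (Polynomial.X - 1) := by
  refine Polynomial.funext fun t => ?_
  rw [Polynomial.eval_comp, eval_charpoly, eval_charpoly]
  congr 1
  simp only [Polynomial.eval_sub, Polynomial.eval_X, Polynomial.eval_one, map_sub, map_one]
  abel

theorem isSignedBlowup_completeMultipartiteGraph (n : Fin 4 → ℕ) :
    IsSignedBlowup (seidelMatrix (SimpleGraph.completeMultipartiteGraph fun i => Fin (n i)) + 1)
      Sigma.fst 1 := by
  classical
  refine ⟨fun _ => Or.inl rfl, fun x y => ?_⟩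
  rw [seidelMatrix_add_one_apply, quotientMatrix_apply]
  by_cases h : x.1 = y.1 <;> simp [SimpleGraph.completeMultipartiteGraph, h]

/-- A graph whose Seidel matrix is a signed blow-up is switching equivalent to the complete
multipartite graph with the corresponding parts. -/
theorem IsSignedBlowup.adj_seidelSwitch {H : SimpleGraph V} {f : V → Fin 4} {s : V → ℝ}
    (h : IsSignedBlowup (seidelMatrix H + 1) f s) (x y : V) :
    (seidelSwitch H {u | s u = 1}).Adj x y ↔ f x ≠ f y := by
  classical
  have hxy := h.2 x y
  rw [seidelMatrix_add_one_apply, quotientMatrix_apply] at hxy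
  simp only [seidelSwitch, Set.mem_ofPred_eq]
  rcases h.1 x with hx | hx <;> rcases h.1 y with hy | hy <;> rw [hx, hy] at hxy ⊢ <;>
    revert hxy <;> by_cases hH : H.Adj x y <;> by_cases hf : f x = f y <;> norm_num [hH, hf]

theorem IsSignedBlowup.charpoly_quotient_eq {W : Type v} [Fintype W] [DecidableEq W]
    {M : Matrix V V ℝ} {N : Matrix W W ℝ} {f : V → Fin 4} {g : W → Fin 4} {s : V → ℝ} {t : W → ℝ}
    (hM : IsSignedBlowup M f s) (hN : IsSignedBlowup N g t) (h : M.charpoly = N.charpoly) :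
    (quotientMatrix * diagonal fun i => (Fintype.card {u // f u = i} : ℝ)).charpoly =
      (quotientMatrix * diagonal fun i => (Fintype.card {u // g u = i} : ℝ)).charpoly := by
  have hcard : Fintype.card V = Fintype.card W := by
    rw [← charpoly_natDegree_eq_dim M, h, charpoly_natDegree_eq_dim]
  refine mul_left_cancel₀ (pow_ne_zero (Fintype.card V) Polynomial.X_ne_zero) ?_
  rw [← hM.charpoly, h, hN.charpoly, hcard]

theorem esymm_eq_of_charpoly_eq {d e : Fin 4 → ℕ}
    (h : (quotientMatrix * diagonal fun i => (d i : ℝ)).charpoly =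
      (quotientMatrix * diagonal fun i => (e i : ℝ)).charpoly) :
    d 0 + d 1 + d 2 + d 3 = e 0 + e 1 + e 2 + e 3 ∧
    d 0 * d 1 * d 2 + d 0 * d 1 * d 3 + d 0 * d 2 * d 3 + d 1 * d 2 * d 3
      = e 0 * e 1 * e 2 + e 0 * e 1 * e 3 + e 0 * e 2 * e 3 + e 1 * e 2 * e 3 ∧
    d 0 * d 1 * d 2 * d 3 = e 0 * e 1 * e 2 * e 3 := by
  have ht (t : ℝ) := congrArg (Polynomial.eval t) h
  simp only [eval_charpoly_quotientMatrix_mul_diagonal] at ht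
  -- `t = 0` isolates e4; `t = 1` and `t = 2` then give independent equations for e1 and e3.
  have h0 := ht 0
  have h1 := ht 1
  have h2 := ht (-1)
  have h3 := ht 2
  rify
  refine ⟨?_, ?_, ?_⟩ <;> linarith

omit [DecidableEq V] in
theorem nonempty_iso_completeMultipartiteGraph {G : SimpleGraph V} {f : V → Fin 4}
    {n : Fin 4 → ℕ} (σ : Equiv.Perm (Fin 4)) (hσ : ∀ i, n (σ i) = Fintype.card {u // f u = i})
    (hG : ∀ x y, G.Adj x y ↔ f x ≠ f y) :
    Nonempty (G ≃g SimpleGraph.completeMultipartiteGraph fun i => Fin (n i)) := by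
  have hcard (i : Fin 4) : Fintype.card {u // σ (f u) = i} =
      Fintype.card {x : Σ i, Fin (n i) // x.1 = i} := by
    have h1 : Fintype.card {u // σ (f u) = i} = n i := by
      rw [← σ.apply_symm_apply i, hσ]
      exact Fintype.card_congr (Equiv.subtypeEquivRight fun u => σ.injective.eq_iff)
    rw [h1, Fintype.card_congr (Equiv.sigmaSubtype i), Fintype.card_fin]
  let e := Equiv.ofFiberEquiv fun i => Fintype.equivOfCardEq (hcard i)
  have he (u : V) : (e u).1 = σ (f u) :=
    Equiv.ofFiberEquiv_map (fun i => Fintype.equivOfCardEq (hcard i)) u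
  refine ⟨⟨e, ?_⟩⟩
  intro x y
  rw [hG]
  simp [SimpleGraph.completeMultipartiteGraph, he]

end

end

theorem mainTheorem4 (n : Fin 4 → ℕ) (hpos : ∀ i, 0 < n i)
    (hprime : (Finset.univ.sup n).Prime) :
    IsSeidelDetermined.{0, v} (SimpleGraph.completeMultipartiteGraph (fun i => Fin (n i))) := by
  classical
  intro W _ _ H hspec
  have hS := charpoly_seidelMatrix_eq_of_seidelSpectrum_eq hspec
  have hM := (charpoly_add_one (seidelMatrix H)).trans ((congrArg (Polynomial.comp · _) hS).trans
    (charpoly_add_one _).symm)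
  have hn := isSignedBlowup_completeMultipartiteGraph n
  have hrank : (seidelMatrix H + 1).rank = 4 := by
    rw [(isSymm_seidelMatrix_add_one H).isHermitian.rank_eq_countP_roots_charpoly, hM,
      ← (isSymm_seidelMatrix_add_one _).isHermitian.rank_eq_countP_roots_charpoly]
    exact hn.rank_eq fun i => ⟨⟨i, 0, hpos i⟩, rfl⟩
  obtain ⟨f, s, hfs⟩ := exists_isSignedBlowup (isSymm_seidelMatrix_add_one H)
    (fun u => by rw [seidelMatrix_add_one_apply, if_neg (H.loopless.irrefl u)])
    (fun u v => by rw [seidelMatrix_add_one_apply]; split_ifs <;> simp) hrank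
  have hfib (i : Fin 4) : Fintype.card {x : Σ i, Fin (n i) // x.1 = i} = n i := by
    rw [Fintype.card_congr (Equiv.sigmaSubtype i), Fintype.card_fin]
  have hQ := hfs.charpoly_quotient_eq hn hM
  simp only [hfib] at hQ
  -- Nothing yet says that `f` is onto; equality of e4 will exclude empty fibres.
  obtain ⟨m, hm⟩ : ∃ m : Fin 4 → ℕ, ∀ i, Fintype.card {u // f u = i} = m i := ⟨_, fun _ => rfl⟩
  simp only [hm] at hQ
  obtain ⟨h1, h3, h4⟩ := esymm_eq_of_charpoly_eq hQ
  obtain ⟨σ, hσ⟩ := exists_perm_of_esymm_eq hpos hprime h1.symm h3.symm h4.symm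
  exact ⟨_, nonempty_iso_completeMultipartiteGraph σ (fun i => (hσ i).trans (hm i).symm)
    hfs.adj_seidelSwitch, _, rfl⟩
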